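/- Let $m,n$ be coprime positive integers and let $d\ge 1$. A $(dm,dn)$-rational Dyck path is a lattice path from $(0,0)$ to $(dm,dn)$ with unit North and East steps all of whose vertices $(x,y)$ satisfy $my-nx\ge 0$. The rank of a vertex $(x,y)$ is $my-nx$, and the starting rank of a step is the rank of its starting vertex. The sweep-map image of a $(dm,dn)$-rational Dyck path $\overline D$ is the lattice path $D$ that starts at the origin and whose successive steps are the steps of $\overline D$ rearranged by increasing starting rank, where, among steps with equal starting rank, the one whose starting vertex is further to the right comes first. The area of a $(dm,dn)$-rational Dyck path is the number of (whole) unit lattice cells between the path and the diagonal from $(0,0)$ to $(dm,dn)$. The statistic $\operatorname{dinv}(\overline D)$ is the number of unit lattice cells $c$ of the $dm\times dn$ rectangle that lie above $\overline D$ and satisfy $0\le a-b<m+n$, where $a$ is the starting rank of the East step of $\overline D$ below $c$ (in the same column) and $b$ is the starting rank of the North step of $\overline D$ to the right of $c$ (in the same row). Then, for every $(dm,dn)$-rational Dyck path $\overline D$, its sweep-map image $D$ is again a $(dm,dn)$-rational Dyck path, and $$\operatorname{dinv}(\overline D)=\operatorname{area}(D).$$ -/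

import Mathlib

namespace RationalDyck

/-- A unit lattice step: North `(0, 1)` or East `(1, 0)`. -/
inductive Step where
  | north : Step
  | east : Step
  deriving DecidableEq

/-- The horizontal coordinate of the vertex reached after the first `i` steps of the lattice path
`p`, which starts at the origin; for `i < p.length` this vertex is the starting point of the
step number `i` (counted from `0`). -/
def xCoord (p : List Step) (i : ℕ) : ℕ := (p.take i).count Step.east

/-- The vertical coordinate of the vertex reached after the first `i` steps. -/
def yCoord (p : List Step) (i : ℕ) : ℕ := (p.take i).count Step.north

/-- The rank of the vertex reached after the first `i` steps: the origin has rank `0`, a North step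
adds `m`, an East step subtracts `n`. For `i < p.length` this is the starting rank of
step number `i`. -/
def rank (m n : ℕ) (p : List Step) (i : ℕ) : ℤ :=
  (m : ℤ) * yCoord p i - (n : ℤ) * xCoord p i

/-- `p` is a `(dm, dn)`-rational Dyck path: it goes from `(0, 0)` to `(dm, dn)` and none of its
vertices lies below the diagonal `m * y = n * x`. -/
def IsDyck (m n d : ℕ) (p : List Step) : Prop :=
  p.count Step.east = d * m ∧ p.count Step.north = d * n ∧
    ∀ i ≤ p.length, 0 ≤ rank m n p i

/-- The sweep order on the steps of `p`: smaller starting rank first; among equal starting ranks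
the starting point further to the right, which is the one later along the path, first. -/
def SweepLE (m n : ℕ) (p : List Step) (i j : Fin p.length) : Prop :=
  rank m n p i < rank m n p j ∨ (rank m n p i = rank m n p j ∧ j ≤ i)

instance (m n : ℕ) (p : List Step) (i j : Fin p.length) : Decidable (SweepLE m n p i j) :=
  inferInstanceAs (Decidable (_ ∨ _))

/-- The sweep map: the steps of `p`, rearranged in the sweep order. -/
def sweep (m n : ℕ) (p : List Step) : List Step :=
  ((List.finRange p.length).mergeSort (fun i j => decide (SweepLE m n p i j))).map p.get

/-- The lattice cells of the rectangle with opposite corners `(0, 0)` and `(dm, dn)`; a cell is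
given by its South-West corner. -/
def cells (m n d : ℕ) : Finset (ℕ × ℕ) := Finset.range (d * m) ×ˢ Finset.range (d * n)

/-- The cell `c` is below `p`: the East step of `p` in the column of `c` is above `c`. -/
def IsBelowPath (p : List Step) (c : ℕ × ℕ) : Prop :=
  ∃ i : Fin p.length, p.get i = Step.east ∧ xCoord p i = c.1 ∧ c.2 + 1 ≤ yCoord p i

instance (p : List Step) (c : ℕ × ℕ) : Decidable (IsBelowPath p c) :=
  inferInstanceAs (Decidable (∃ _, _))

/-- The cell `c` is (entirely) above the diagonal `m * y = n * x`: its South-East corner is on or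
above it. -/
def IsAboveDiagonal (m n : ℕ) (c : ℕ × ℕ) : Prop := n * (c.1 + 1) ≤ m * c.2

instance (m n : ℕ) (c : ℕ × ℕ) : Decidable (IsAboveDiagonal m n c) :=
  inferInstanceAs (Decidable (_ ≤ _))

/-- The area of a `(dm, dn)`-path: the number of lattice cells between the path and the diagonal. -/
def area (m n d : ℕ) (p : List Step) : ℕ :=
  ((cells m n d).filter fun c => IsBelowPath p c ∧ IsAboveDiagonal m n c).card

/-- The cell `c` is above the path `p` and contributes to its dinv: step `i` is the East step of
`p` in the column of `c`, and it is below `c`; step `j` is the North step of `p` in the row of `c`,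
and it is to the right of `c`; their starting ranks `a` and `b` satisfy `0 ≤ a - b < m + n`. -/
def Contributes (m n : ℕ) (p : List Step) (c : ℕ × ℕ) : Prop :=
  ∃ i j : Fin p.length,
    (p.get i = Step.east ∧ xCoord p i = c.1 ∧ yCoord p i ≤ c.2) ∧
    (p.get j = Step.north ∧ yCoord p j = c.2 ∧ c.1 + 1 ≤ xCoord p j) ∧
    0 ≤ rank m n p i - rank m n p j ∧ rank m n p i - rank m n p j < (m : ℤ) + n

instance (m n : ℕ) (p : List Step) (c : ℕ × ℕ) : Decidable (Contributes m n p c) :=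
  inferInstanceAs (Decidable (∃ _, _))

/-- The dinv of a `(dm, dn)`-path: the number of contributing cells above the path. -/
def dinv (m n d : ℕ) (p : List Step) : ℕ :=
  ((cells m n d).filter fun c => Contributes m n p c).card

end RationalDyck

namespace RationalDyck

open Step

/-! Both sides are compared with the number of cells lying above the diagonal. A cell is the same as
a pair of an East step (its column) and a North step (its row), and it is above a path exactly when
the East step comes first. Hence the area of `D` plus the number of East-before-North pairs of `D`
is the number of cells above the diagonal (`area_add_pairSum`).

In the sweep `D` of a path, an East step of rank `a` precedes a North step of rank `b` when `a < b`,
or when `a = b` and the North step is earlier on the original path. Adding these pairs to those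
counted by dinv leaves a condition on each pair of steps of the original path, encoded by `weight`
(`dinv_add_pairSum_sweep`).

The total weight does not change when a corner East-North becomes North-East without leaving the
region above the diagonal (`pairSum_flip`). Such flips lead to the highest path, where the total is
visibly the number of cells above the diagonal (`pairSum_highest`). That `D` is Dyck follows from
truncating ranks at a level (`sum_rise_nonneg`). -/

/-- The change of rank along a step. -/
def rise (m n : ℕ) : Step → ℤ
  | north => m
  | east => -n

/-- The change of rank along a path. -/
def height (m n : ℕ) (p : List Step) : ℤ := (p.map (rise m n)).sum

/-- The steps of a path with their starting ranks, when the path starts at rank `s`. -/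
def ranked (m n : ℕ) : ℤ → List Step → List (Step × ℤ)
  | _, [] => []
  | s, x :: p => (x, s) :: ranked m n (s + rise m n x) p

/-- The contribution of two steps, the first one being earlier on the path. -/
def weight (m n : ℕ) : Step × ℤ → Step × ℤ → ℤ
  | (east, a), (north, b) => if a - b < m + n then 1 else 0
  | (north, b), (east, a) => if a ≤ b then 1 else 0
  | _, _ => 0

/-- The sum of `f x y` over all pairs of entries of a list with `x` before `y`. -/
def pairSum {α : Type*} (f : α → α → ℤ) : List α → ℤ
  | [] => 0
  | x :: l => (l.map (f x)).sum + pairSum f l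

variable {m n : ℕ}

/-! ### Heights, starting ranks and pair sums -/

@[simp] theorem height_nil : height m n [] = 0 := rfl

@[simp] theorem height_cons (x : Step) (p : List Step) :
    height m n (x :: p) = rise m n x + height m n p := by
  simp [height]

@[simp] theorem height_append (p q : List Step) :
    height m n (p ++ q) = height m n p + height m n q := by
  simp [height]

@[simp] theorem height_replicate (k : ℕ) (x : Step) :
    height m n (List.replicate k x) = k * rise m n x := by
  simp [height]

theorem height_eq_count (p : List Step) :
    height m n p = m * p.count north - n * p.count east := by
  induction p with
  | nil => simp
  | cons x p ih => cases x <;> simp [ih, rise] <;> ring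

theorem rank_eq_height (p : List Step) (i : ℕ) : rank m n p i = height m n (p.take i) := by
  rw [height_eq_count, rank, yCoord, xCoord]

theorem ranked_append (s : ℤ) (p q : List Step) :
    ranked m n s (p ++ q) = ranked m n s p ++ ranked m n (s + height m n p) q := by
  induction p generalizing s with
  | nil => simp [ranked]
  | cons x p ih => simp [ranked, ih, add_assoc]

theorem length_ranked (s : ℤ) (p : List Step) : (ranked m n s p).length = p.length := by
  induction p generalizing s with
  | nil => rfl
  | cons x p ih => simp [ranked, ih]

theorem getElem_ranked (s : ℤ) (p : List Step) (i : ℕ) (hi : i < p.length) :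
    (ranked m n s p)[i]'(by rwa [length_ranked]) = (p[i], s + rank m n p i) := by
  induction p generalizing s i with
  | nil => simp at hi
  | cons x p ih =>
    cases i with
    | zero => simp [ranked, rank_eq_height]
    | succ i =>
      simp only [List.length_cons, Nat.add_lt_add_iff_right] at hi
      simp [ranked, ih _ i hi, rank_eq_height, add_assoc]

theorem ranked_replicate (s : ℤ) (k : ℕ) (x : Step) :
    ranked m n s (List.replicate k x) =
      (List.range k).map fun i : ℕ => (x, s + i * rise m n x) := by
  induction k generalizing s with
  | zero => rfl
  | succ k ih =>
    rw [List.replicate_succ, ranked, ih, List.range_succ_eq_map]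
    simp only [List.map_cons, List.map_map, Nat.cast_zero, zero_mul, add_zero]
    congr 1
    refine List.map_congr_left fun i _ => ?_
    simp only [Function.comp_apply, Nat.succ_eq_add_one, Nat.cast_add, Nat.cast_one]
    congr 1
    ring

theorem pairSum_append {α : Type*} (f : α → α → ℤ) (u v : List α) :
    pairSum f (u ++ v) =
      pairSum f u + pairSum f v + (u.map fun x => (v.map (f x)).sum).sum := by
  induction u with
  | nil => simp [pairSum]
  | cons x u ih => simp [pairSum, ih]; ring

theorem pairSum_eq_zero {α : Type*} {f : α → α → ℤ} {l : List α}
    (h : ∀ x ∈ l, ∀ y ∈ l, f x y = 0) : pairSum f l = 0 := by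
  induction l with
  | nil => rfl
  | cons x l ih =>
    rw [pairSum, ih fun x hx y hy => h x (by simp [hx]) y (by simp [hy]),
      List.map_congr_left (g := fun _ => (0 : ℤ)) fun y hy => h x (by simp) y (by simp [hy])]
    simp

theorem pairSum_eq_sum {α : Type*} (f : α → α → ℤ) (l : List α) :
    pairSum f l = ∑ i : Fin l.length, ∑ j : Fin l.length, if i < j then f l[i] l[j] else 0 := by
  induction l with
  | nil => simp [pairSum]
  | cons x l ih =>
    simp only [List.length_cons]
    rw [Fin.sum_univ_succ]
    simp only [Fin.sum_univ_succ (n := l.length)]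
    simp only [pairSum, ih]
    have : (l.map (f x)).sum = ∑ j : Fin l.length, f x l[j] :=
      (Fin.sum_univ_fun_getElem l (f x)).symm
    simp only [this, Fin.not_lt_zero, if_false, zero_add, Fin.succ_lt_succ_iff, Fin.succ_pos,
      if_true, lt_irrefl]
    rfl

/-! ### Invariance of the total weight under corner flips -/

theorem sum_ranked_telescope {f g : Step × ℤ → ℤ} {h : ℤ → ℤ}
    (hf : ∀ x t, f (x, t) - g (x, t) = h (t + rise m n x) - h t) (s : ℤ) (p : List Step) :
    ((ranked m n s p).map f).sum - ((ranked m n s p).map g).sum = h (s + height m n p) - h s := by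
  induction p generalizing s with
  | nil => simp [ranked]
  | cons x p ih =>
    have h1 := ih (s + rise m n x)
    have h2 := hf x s
    simp only [ranked, List.map_cons, List.sum_cons, height_cons]
    rw [← add_assoc]
    linarith

/-- The effect of the flip on an earlier step is its signed crossing of the level `r + m`, so it
telescopes along the path before the corner. For later steps the level is `r - n`. -/
theorem weight_before_flip (r : ℤ) (x : Step) (t : ℤ) :
    weight m n (x, t) (east, r) + weight m n (x, t) (north, r - n)
      - (weight m n (x, t) (north, r) + weight m n (x, t) (east, r + m)) =
      (if r + m ≤ t + rise m n x then 1 else 0) - (if r + m ≤ t then 1 else 0) := by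
  cases x <;> simp only [weight, rise] <;> split_ifs <;> omega

theorem weight_after_flip (r : ℤ) (x : Step) (t : ℤ) :
    weight m n (east, r) (x, t) + weight m n (north, r - n) (x, t)
      - (weight m n (north, r) (x, t) + weight m n (east, r + m) (x, t)) =
      (if r - n < t + rise m n x then 1 else 0) - (if r - n < t then 1 else 0) := by
  cases x <;> simp only [weight, rise] <;> split_ifs <;> omega

theorem pairSum_flip (hm : 0 < m) (u v : List Step)
    (hr : n ≤ height m n u) (hend : height m n u + m - n + height m n v = 0) :
    pairSum (weight m n) (ranked m n 0 (u ++ east :: north :: v)) =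
      pairSum (weight m n) (ranked m n 0 (u ++ north :: east :: v)) := by
  set r := height m n u with hrdef
  have h1 := sum_ranked_telescope (m := m) (n := n)
    (f := fun y => weight m n y (east, r) + weight m n y (north, r - n))
    (g := fun y => weight m n y (north, r) + weight m n y (east, r + m))
    (h := fun t => if r + m ≤ t then 1 else 0) (weight_before_flip r) 0 u
  have h2 := sum_ranked_telescope (m := m) (n := n)
    (f := fun y => weight m n (east, r) y + weight m n (north, r - n) y)
    (g := fun y => weight m n (north, r) y + weight m n (east, r + m) y)
    (h := fun t => if r - n < t then 1 else 0) (weight_after_flip r) (r + m - n) v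
  -- The path before the corner runs from rank `0` to `r`, both below `r + m`: no net crossing.
  rw [zero_add, ← hrdef, if_neg (by omega), if_neg (by omega)] at h1
  -- The path after the corner runs from `r + m - n`, above `r - n`, down to `0`, not above it: net
  -- `-1`. This cancels the `1` gained by the corner pair itself (`e3`, `e4`).
  rw [hend, if_neg (by omega), if_pos (by omega)] at h2
  simp only [List.sum_map_add] at h1 h2
  have e1 : r - (n : ℤ) + m = r + m - n := by ring
  have e3 : weight m n (east, r) (north, r - n) = 1 := by
    simp only [weight]; rw [if_pos (by omega)]
  have e4 : weight m n (north, r) (east, r + m) = 0 := by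
    simp only [weight]; rw [if_neg (by omega)]
  simp only [ranked_append, ranked, zero_add, ← hrdef, rise, e1, pairSum_append, pairSum,
    List.map_cons, List.sum_cons, List.sum_map_add, ← sub_eq_add_neg, e3, e4]
  linarith

theorem pairSum_move_north (hm : 0 < m) (k : ℕ) (u v : List Step)
    (hr : n * k ≤ height m n u) (hend : height m n u - n * k + m + height m n v = 0) :
    pairSum (weight m n) (ranked m n 0 (u ++ (List.replicate k east ++ north :: v))) =
      pairSum (weight m n) (ranked m n 0 (u ++ north :: (List.replicate k east ++ v))) := by
  induction k generalizing v with
  | zero => simp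
  | succ k ih =>
    push_cast at hr hend
    have h1 := pairSum_flip (n := n) hm (u ++ List.replicate k east) v
      (by simp [rise]; nlinarith) (by simp [rise]; linarith)
    have h2 := ih (east :: v) (by nlinarith) (by simp [rise]; linarith)
    simp only [List.replicate_succ', List.append_assoc, List.cons_append, List.nil_append]
      at h1 h2 ⊢
    rw [h1, h2]

/-- The part already read is kept in the form North^a East^b. An East step just extends it; a North
step is moved left past all `b` East steps, which is legitimate because the rank before it is
nonnegative. -/
theorem pairSum_straighten (hm : 0 < m) (v : List Step) (a b : ℕ)
    (hend : (m * a - n * b : ℤ) + height m n v = 0)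
    (hv : ∀ i ≤ v.length, 0 ≤ (m * a - n * b : ℤ) + rank m n v i) :
    pairSum (weight m n) (ranked m n 0 (List.replicate a north ++ (List.replicate b east ++ v))) =
      pairSum (weight m n) (ranked m n 0 (List.replicate (a + v.count north) north ++
        List.replicate (b + v.count east) east)) := by
  induction v generalizing a b with
  | nil => simp
  | cons x v ih =>
    have h0 := hv 0 (Nat.zero_le _)
    have hs : ∀ i ≤ v.length, 0 ≤ (m * a - n * b : ℤ) + (rise m n x + rank m n v i) := by
      intro i hi
      simpa [rank_eq_height] using hv (i + 1) (by simpa using hi)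
    simp only [rank_eq_height, List.take_zero, height_nil, add_zero] at h0
    rw [height_cons] at hend
    cases x with
    | east =>
      have := ih a (b + 1) (by push_cast; simp only [rise] at hend; linarith)
        (fun i hi => by have := hs i hi; push_cast; simp only [rise] at this; linarith)
      rw [List.replicate_succ'] at this
      simp only [List.append_assoc, List.cons_append, List.nil_append] at this
      rw [this]
      simp [add_assoc, add_comm 1]
    | north =>
      have := ih (a + 1) b (by push_cast; simp only [rise] at hend; linarith)
        (fun i hi => by have := hs i hi; push_cast; simp only [rise] at this; linarith)
      rw [List.replicate_succ'] at this
      simp only [List.append_assoc, List.cons_append, List.nil_append] at this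
      rw [pairSum_move_north hm b _ v (by simp [rise]; linarith)
        (by simp [rise]; simp only [rise] at hend; linarith), this]
      simp [add_assoc, add_comm 1]

/-! ### The highest path -/

theorem sum_map_range (f : ℕ → ℤ) (k : ℕ) :
    ((List.range k).map f).sum = ∑ i ∈ Finset.range k, f i := rfl

theorem pairSum_highest (m n d : ℕ) :
    pairSum (weight m n) (ranked m n 0 (List.replicate (d * n) north ++
      List.replicate (d * m) east)) = ((cells m n d).filter (IsAboveDiagonal m n)).card := by
  rw [ranked_append, pairSum_append, pairSum_eq_zero, pairSum_eq_zero, ranked_replicate,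
    ranked_replicate, Finset.card_filter, cells, Finset.sum_product_right]
  · simp only [List.map_map, height_replicate, rise, zero_add, Function.comp_def, weight]
    rw [Nat.cast_sum]
    refine (sum_map_range _ _).trans (Finset.sum_congr rfl fun j _ => ?_)
    -- East step `i` of the highest path starts at rank `n * (d * m - i)`, so it is matched with
    -- column `d * m - 1 - i`; the weight condition then says that the cell is above the diagonal.
    rw [sum_map_range, ← Finset.sum_range_reflect, Nat.cast_sum]
    refine Finset.sum_congr rfl fun i hi => ?_
    rw [Finset.mem_range] at hi
    have hi' : ((d * m - 1 - i : ℕ) : ℤ) = d * m - 1 - i := by push_cast [Nat.sub_sub, hi]; omega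
    rw [hi', Nat.cast_ite, Nat.cast_one, Nat.cast_zero]
    refine if_congr ?_ rfl rfl
    rw [IsAboveDiagonal]
    zify
    constructor <;> intro h <;> linarith
  · simp only [ranked_replicate, List.mem_map]
    rintro _ ⟨i, -, rfl⟩ _ ⟨j, -, rfl⟩
    rfl
  · simp only [ranked_replicate, List.mem_map]
    rintro _ ⟨i, -, rfl⟩ _ ⟨j, -, rfl⟩
    rfl

theorem pairSum_eq_card_above_diagonal (hm : 0 < m) {d : ℕ} {p : List Step}
    (hp : IsDyck m n d p) : pairSum (weight m n) (ranked m n 0 p) =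
      ((cells m n d).filter (IsAboveDiagonal m n)).card := by
  obtain ⟨he, hn, hr⟩ := hp
  have := pairSum_straighten (m := m) (n := n) hm p 0 0
    (by rw [height_eq_count, he, hn]; push_cast; ring) (by simpa using hr)
  simpa [he, hn, pairSum_highest] using this

/-! ### Cells as pairs of an East and a North step -/

theorem count_take_succ (x : Step) {p : List Step} {i : ℕ} (hi : i < p.length) :
    (p.take (i + 1)).count x = (p.take i).count x + if p[i] = x then 1 else 0 := by
  rw [List.take_succ_eq_append_getElem hi, List.count_append, List.count_singleton]
  simp

theorem count_take_mono (x : Step) (p : List Step) {i j : ℕ} (h : i ≤ j) :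
    (p.take i).count x ≤ (p.take j).count x :=
  (List.take_sublist_take_left h).count_le x

theorem count_take_lt {x : Step} {p : List Step} {i : Fin p.length} {j : ℕ} (hx : p.get i = x)
    (h : i < j) : (p.take i).count x < (p.take j).count x := by
  have h1 := count_take_succ x i.2
  rw [if_pos (by simpa using hx)] at h1
  have h2 := count_take_mono x p (Nat.succ_le_of_lt h)
  simp only [Nat.succ_eq_add_one] at h2
  omega

theorem count_take_lt_count {x : Step} {p : List Step} {i : Fin p.length} (hx : p.get i = x) :
    (p.take i).count x < p.count x := by
  simpa using count_take_lt hx i.2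

theorem count_take_injective {x : Step} {p : List Step} {i j : Fin p.length} (hi : p.get i = x)
    (hj : p.get j = x) (h : (p.take i).count x = (p.take j).count x) : i = j := by
  rcases lt_trichotomy i j with hij | hij | hij
  · have := count_take_lt hi (j := j) hij
    omega
  · exact hij
  · have := count_take_lt hj (j := i) hij
    omega

theorem exists_count_take_eq {x : Step} {p : List Step} {k : ℕ} (hk : k < p.count x) :
    ∃ i : Fin p.length, p.get i = x ∧ (p.take i).count x = k := by
  induction p generalizing k with
  | nil => simp at hk
  | cons y p ih =>
    by_cases hy : y = x
    · subst hy
      cases k with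
      | zero => exact ⟨⟨0, by simp⟩, by simp⟩
      | succ k =>
        obtain ⟨i, h1, h2⟩ := ih (k := k) (by simpa using hk)
        exact ⟨i.succ, by simpa using h1, by simpa using h2⟩
    · obtain ⟨i, h1, h2⟩ := ih (k := k) (by simpa [List.count_cons, hy] using hk)
      exact ⟨i.succ, by simpa using h1, by simpa [List.count_cons, hy] using h2⟩

/-- Cells correspond to pairs of an East step (their column) and a North step (their row). -/
theorem card_cells_eq_card_pairs {d : ℕ} {p : List Step} (he : p.count east = d * m)
    (hn : p.count north = d * n) (Q : ℕ × ℕ → Prop) [DecidablePred Q]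
    (P : Fin p.length → Fin p.length → Prop) [∀ i j, Decidable (P i j)]
    (h : ∀ i j, p.get i = east → p.get j = north → (Q (xCoord p i, yCoord p j) ↔ P i j)) :
    (((cells m n d).filter Q).card : ℤ) = ∑ i, ∑ j,
      if p.get i = east ∧ p.get j = north ∧ P i j then 1 else 0 := by
  rw [← Finset.sum_product', Finset.sum_boole, Nat.cast_inj]
  symm
  refine Finset.card_bij (fun ij _ => (xCoord p ij.1, yCoord p ij.2)) ?_ ?_ ?_
  · rintro ⟨i, j⟩ hij
    obtain ⟨-, hi, hj, hP⟩ := Finset.mem_filter.1 hij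
    rw [Finset.mem_filter, cells, Finset.mem_product, Finset.mem_range, Finset.mem_range, ← he,
      ← hn]
    exact ⟨⟨count_take_lt_count hi, count_take_lt_count hj⟩, (h i j hi hj).2 hP⟩
  · rintro ⟨i, j⟩ hij ⟨i', j'⟩ hij' heq
    obtain ⟨-, hi, hj, -⟩ := Finset.mem_filter.1 hij
    obtain ⟨-, hi', hj', -⟩ := Finset.mem_filter.1 hij'
    obtain ⟨h1, h2⟩ := Prod.mk.inj heq
    exact Prod.ext (count_take_injective hi hi' h1) (count_take_injective hj hj' h2)
  · rintro ⟨x, y⟩ hc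
    rw [Finset.mem_filter, cells, Finset.mem_product, Finset.mem_range, Finset.mem_range, ← he,
      ← hn] at hc
    obtain ⟨⟨hx, hy⟩, hQ⟩ := hc
    obtain ⟨i, hi, rfl⟩ := exists_count_take_eq hx
    obtain ⟨j, hj, rfl⟩ := exists_count_take_eq hy
    exact ⟨(i, j), Finset.mem_filter.2 ⟨Finset.mem_univ _, hi, hj, (h i j hi hj).1 hQ⟩, rfl⟩

theorem yCoord_le_iff {p : List Step} {i j : Fin p.length} (hi : p.get i = east)
    (hj : p.get j = north) : yCoord p i ≤ yCoord p j ↔ i < j := by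
  constructor
  · intro h
    by_contra hij
    rcases (not_lt.1 hij).lt_or_eq with hji | rfl
    · have := count_take_lt hj (j := i) hji
      rw [yCoord, yCoord] at h
      omega
    · exact absurd (hi.symm.trans hj) (by decide)
  · exact fun h => count_take_mono north p (Fin.le_def.1 h.le)

theorem dinv_eq_sum {d : ℕ} {p : List Step} (he : p.count east = d * m)
    (hn : p.count north = d * n) : (dinv m n d p : ℤ) = ∑ i, ∑ j,
      if p.get i = east ∧ p.get j = north ∧ i < j ∧ 0 ≤ rank m n p i - rank m n p j ∧
        rank m n p i - rank m n p j < (m : ℤ) + n then 1 else 0 := by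
  refine card_cells_eq_card_pairs he hn _
    (fun i j => i < j ∧ 0 ≤ rank m n p i - rank m n p j ∧
      rank m n p i - rank m n p j < (m : ℤ) + n) fun i j hi hj => ?_
  constructor
  · rintro ⟨i', j', ⟨hi', h1, h2⟩, ⟨hj', h3, -⟩, h4⟩
    obtain rfl := count_take_injective hi' hi h1
    obtain rfl := count_take_injective hj' hj h3
    exact ⟨(yCoord_le_iff hi hj).1 h2, h4⟩
  · rintro ⟨hij, h⟩
    exact ⟨i, j, ⟨hi, rfl, (yCoord_le_iff hi hj).2 hij⟩, ⟨hj, rfl, count_take_lt hi hij⟩, h⟩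

/-- The weight of an East step followed by a North step is `1`. -/
def eastNorth (x y : Step) : ℤ := if x = east ∧ y = north then 1 else 0

theorem area_add_pairSum {d : ℕ} {p : List Step} (hp : IsDyck m n d p) :
    (area m n d p : ℤ) + pairSum eastNorth p =
      ((cells m n d).filter (IsAboveDiagonal m n)).card := by
  obtain ⟨he, hn, hr⟩ := hp
  have key : ∀ i j : Fin p.length, p.get i = east → p.get j = north →
      ((IsAboveDiagonal m n (xCoord p i, yCoord p j) ∧ ¬ IsBelowPath p (xCoord p i, yCoord p j)) ↔
        i < j) := by
    intro i j hi hj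
    rw [← yCoord_le_iff hi hj]
    constructor
    · rintro ⟨-, h⟩
      by_contra hij
      exact h ⟨i, hi, rfl, by simp only; omega⟩
    · intro hij
      refine ⟨?_, ?_⟩
      -- A cell above the path is above the diagonal: the vertex ending the East step has
      -- nonnegative rank and is at or below the South-East corner of the cell.
      · have h1 := hr (i + 1) i.2
        have h2 := count_take_succ east i.2
        have h3 := count_take_succ north i.2
        rw [if_pos (by simpa using hi)] at h2
        rw [if_neg (by simp at hi; simp [hi])] at h3
        rw [rank, xCoord, yCoord, h2, h3] at h1
        rw [IsAboveDiagonal]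
        have h4 : m * yCoord p i ≤ m * yCoord p j := Nat.mul_le_mul_left _ hij
        refine le_trans ?_ h4
        zify
        push_cast [xCoord, yCoord] at h1 ⊢
        linarith
      · rintro ⟨i', hi', h1, h2⟩
        obtain rfl := count_take_injective hi' hi h1
        simp only at h2
        omega
  have h1 := card_cells_eq_card_pairs he hn
    (fun c => IsAboveDiagonal m n c ∧ ¬ IsBelowPath p c) (fun i j => i < j) key
  have h2 : pairSum eastNorth p = ∑ i : Fin p.length, ∑ j : Fin p.length,
      if p.get i = east ∧ p.get j = north ∧ i < j then 1 else 0 := by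
    rw [pairSum_eq_sum]
    refine Finset.sum_congr rfl fun i _ => Finset.sum_congr rfl fun j _ => ?_
    simp only [eastNorth, ← ite_and]
    refine if_congr ?_ rfl rfl
    simp only [Fin.getElem_fin, List.get_eq_getElem]
    tauto
  rw [h2, ← h1, area, ← Nat.cast_add, Nat.cast_inj, ← Finset.filter_filter, ← Finset.filter_filter,
    Finset.filter_comm, Finset.card_filter_add_card_filter_not]

/-! ### The sweep order and its inversions -/

theorem pairSum_map {α β : Type*} (g : β → β → ℤ) (f : α → β) (l : List α) :
    pairSum g (l.map f) = pairSum (fun x y => g (f x) (f y)) l := by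
  induction l with
  | nil => rfl
  | cons x l ih => simp [pairSum, ih, Function.comp_def]

/-- Frees a pair sum from the order of its list, so that sums over the sweep order and over the path
order can be compared term by term. -/
theorem pairSum_of_pairwise {ι : Type*} [Fintype ι] [DecidableEq ι] {r : ι → ι → Prop}
    [∀ i j, Decidable (r i j)] (hr : ∀ i j, r i j → r j i → i = j) {f : ι → ι → ℤ}
    (hf : ∀ i, f i i = 0) {l : List ι} (hl : l.Pairwise r) (hnd : l.Nodup) (hmem : ∀ i, i ∈ l) :
    pairSum f l = ∑ i, ∑ j, if r i j then f i j else 0 := by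
  rw [pairSum_eq_sum, ← (hnd.getEquivOfForallMemList l hmem).sum_comp]
  refine Finset.sum_congr rfl fun i _ => ?_
  rw [← (hnd.getEquivOfForallMemList l hmem).sum_comp]
  refine Finset.sum_congr rfl fun j _ => ?_
  simp only [List.Nodup.getEquivOfForallMemList_apply, List.get_eq_getElem, Fin.getElem_fin]
  rw [List.pairwise_iff_getElem] at hl
  rcases lt_trichotomy i j with hij | rfl | hij
  · rw [if_pos hij, if_pos (hl _ _ _ _ hij)]
  · simp [hf]
  · rw [if_neg hij.not_gt, if_neg]
    intro h
    have := hr _ _ h (hl _ _ _ _ hij)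
    rw [hnd.getElem_inj_iff] at this
    exact hij.ne' (Fin.ext this)

theorem SweepLE.antisymm {p : List Step} {i j : Fin p.length} (h : SweepLE m n p i j)
    (h' : SweepLE m n p j i) : i = j := by
  rcases h with h | ⟨h1, h2⟩ <;> rcases h' with h' | ⟨h3, h4⟩
  · omega
  · omega
  · omega
  · exact le_antisymm h4 h2

theorem SweepLE.trans {p : List Step} {i j k : Fin p.length} (h : SweepLE m n p i j)
    (h' : SweepLE m n p j k) : SweepLE m n p i k := by
  rw [SweepLE] at *
  omega

theorem SweepLE.total (p : List Step) (i j : Fin p.length) :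
    SweepLE m n p i j ∨ SweepLE m n p j i := by
  rw [SweepLE, SweepLE]
  omega

theorem SweepLE.rank_le {p : List Step} {i j : Fin p.length} (h : SweepLE m n p i j) :
    rank m n p i ≤ rank m n p j := by
  rw [SweepLE] at h
  omega

/-- The step numbers of `p` in the sweep order. -/
def sweepOrder (m n : ℕ) (p : List Step) : List (Fin p.length) :=
  (List.finRange p.length).mergeSort fun i j => decide (SweepLE m n p i j)

theorem sweepOrder_perm (m n : ℕ) (p : List Step) :
    (sweepOrder m n p).Perm (List.finRange p.length) :=
  List.mergeSort_perm _ _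

theorem sweepOrder_pairwise (m n : ℕ) (p : List Step) :
    (sweepOrder m n p).Pairwise (SweepLE m n p) := by
  have := List.pairwise_mergeSort (le := fun i j => decide (SweepLE m n p i j))
    (fun i j k h h' => by simp only [decide_eq_true_eq] at *; exact h.trans h')
    (fun i j => by simpa using SweepLE.total p i j) (List.finRange p.length)
  exact this.imp of_decide_eq_true

theorem sweepOrder_nodup (m n : ℕ) (p : List Step) : (sweepOrder m n p).Nodup :=
  (sweepOrder_perm m n p).nodup_iff.2 (List.nodup_finRange _)

theorem mem_sweepOrder (m n : ℕ) (p : List Step) (i : Fin p.length) : i ∈ sweepOrder m n p :=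
  (sweepOrder_perm m n p).mem_iff.2 (List.mem_finRange i)

theorem sweep_perm (m n : ℕ) (p : List Step) : (sweep m n p).Perm p := by
  have := (sweepOrder_perm m n p).map p.get
  rwa [List.map_get_finRange] at this

theorem pairSum_sweep (m n : ℕ) (p : List Step) : pairSum eastNorth (sweep m n p) =
    ∑ i, ∑ j, if SweepLE m n p i j then eastNorth (p.get i) (p.get j) else 0 := by
  rw [sweep, pairSum_map]
  refine pairSum_of_pairwise (fun i j => SweepLE.antisymm) (fun i => ?_)
    (sweepOrder_pairwise m n p) (sweepOrder_nodup m n p) (mem_sweepOrder m n p)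
  simp only [eastNorth, ite_eq_right_iff]
  rintro ⟨h1, h2⟩
  exact absurd (h1.symm.trans h2) (by decide)

/-! ### The sweep of a Dyck path is Dyck -/

theorem rank_succ {p : List Step} (i : Fin p.length) :
    rank m n p (i + 1) = rank m n p i + rise m n (p.get i) := by
  rw [rank_eq_height, rank_eq_height, List.take_succ_eq_append_getElem i.2,
    height_append, height_cons, height_nil, add_zero]
  rfl

/-- The steps of a closed walk that start low rise at least `0` in total. -/
theorem sum_rise_nonneg {p : List Step} (hp : height m n p = 0) (S : Finset (Fin p.length))
    (t : ℤ) (hS : ∀ i ∈ S, rank m n p i ≤ t) (hS' : ∀ i ∉ S, t ≤ rank m n p i) :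
    0 ≤ ∑ i ∈ S, rise m n (p.get i) := by
  -- Ranks truncated at `t` also return to their initial value. A step of `S` changes the truncated
  -- rank by at most its rise, any other step by at most `0`.
  have h0 : ∑ i : Fin p.length, (min (rank m n p (i + 1)) t - min (rank m n p i) t) = 0 := by
    rw [← Finset.sum_range fun i => min (rank m n p (i + 1)) t - min (rank m n p i) t,
      Finset.sum_range_sub fun i => min (rank m n p i) t]
    simp [rank_eq_height, hp]
  rw [← Finset.sum_add_sum_compl S] at h0
  have h1 : ∑ i ∈ S, (min (rank m n p (i + 1)) t - min (rank m n p i) t) ≤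
      ∑ i ∈ S, rise m n (p.get i) := by
    refine Finset.sum_le_sum fun i hi => ?_
    have := hS i hi
    have := rank_succ (m := m) (n := n) i
    omega
  have h2 : ∑ i ∈ Sᶜ, (min (rank m n p (i + 1)) t - min (rank m n p i) t) ≤ 0 := by
    refine Finset.sum_nonpos fun i hi => ?_
    have := hS' i (Finset.mem_compl.1 hi)
    omega
  linarith

theorem IsDyck.height_eq_zero {d : ℕ} {p : List Step} (hp : IsDyck m n d p) :
    height m n p = 0 := by
  rw [height_eq_count, hp.1, hp.2.1]
  push_cast
  ring

theorem IsDyck.sweep {d : ℕ} {p : List Step} (hp : IsDyck m n d p) :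
    IsDyck m n d (sweep m n p) := by
  refine ⟨(sweep_perm m n p).count_eq _ ▸ hp.1, (sweep_perm m n p).count_eq _ ▸ hp.2.1, ?_⟩
  intro k hk
  cases k with
  | zero => simp [rank_eq_height]
  | succ k =>
    have hk' : k < (sweepOrder m n p).length := by
      simpa [RationalDyck.sweep, sweepOrder] using hk
    have hnd := sweepOrder_nodup m n p
    have hpw := List.pairwise_iff_getElem.1 (sweepOrder_pairwise m n p)
    -- The threshold is the rank of the last of the first `k + 1` swept steps, whose total rise is
    -- the rank to be bounded.
    have h := sum_rise_nonneg hp.height_eq_zero ((sweepOrder m n p).take (k + 1)).toFinset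
      (rank m n p ((sweepOrder m n p)[k])) (fun i hi => ?_) (fun i hi => ?_)
    · rw [List.sum_toFinset _ (hnd.sublist (List.take_sublist _ _))] at h
      rw [rank_eq_height, height, RationalDyck.sweep, ← List.map_take, List.map_map]
      exact h
    · rw [List.mem_toFinset, List.mem_take_iff_getElem] at hi
      obtain ⟨l, hl, rfl⟩ := hi
      rcases (show l ≤ k by omega).lt_or_eq with hlk | rfl
      · exact (hpw _ _ _ _ hlk).rank_le
      · exact le_rfl
    · obtain ⟨l, hl, rfl⟩ := List.getElem_of_mem (mem_sweepOrder m n p i)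
      rw [List.mem_toFinset, List.mem_take_iff_getElem] at hi
      have hkl : k < l := by
        by_contra hlk
        exact hi ⟨l, by omega, rfl⟩
      exact (hpw _ _ _ _ hkl).rank_le

/-! ### Dinv plus sweep inversions is the total weight -/

theorem pairSum_ranked_eq_sum (p : List Step) :
    pairSum (weight m n) (ranked m n 0 p) = ∑ i : Fin p.length, ∑ j : Fin p.length,
      if i < j then weight m n (p.get i, rank m n p i) (p.get j, rank m n p j) else 0 := by
  have h : ranked m n 0 p =
      (List.finRange p.length).map fun i => (p.get i, rank m n p i) := by
    refine List.ext_getElem (by simp [length_ranked]) fun i h1 h2 => ?_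
    rw [getElem_ranked _ _ _ (by simpa using h2)]
    simp
  rw [h, pairSum_map]
  refine pairSum_of_pairwise (r := fun i j => i < j) (fun i j h h' => absurd h' h.not_gt)
    (fun i => ?_) (List.pairwise_lt_finRange _) (List.nodup_finRange _) List.mem_finRange
  cases p.get i <;> rfl

theorem dinv_add_pairSum_sweep {d : ℕ} {p : List Step} (he : p.count east = d * m)
    (hn : p.count north = d * n) :
    (dinv m n d p : ℤ) + pairSum eastNorth (sweep m n p) =
      pairSum (weight m n) (ranked m n 0 p) := by
  rw [dinv_eq_sum he hn, pairSum_sweep, pairSum_ranked_eq_sum]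
  have split : ∀ i j : Fin p.length,
      (if i < j then weight m n (p.get i, rank m n p i) (p.get j, rank m n p j) else 0) =
      (if p.get i = east ∧ p.get j = north ∧ i < j ∧ rank m n p i - rank m n p j < m + n
        then 1 else 0) +
      if p.get j = east ∧ p.get i = north ∧ i < j ∧ rank m n p j ≤ rank m n p i
        then 1 else 0 := by
    intro i j
    cases p.get i <;> cases p.get j <;> simp [weight, ite_and]
  simp only [split, Finset.sum_add_distrib]
  -- Swaps the roles of the indices in the North-before-East terms, so that `i` is the East step
  -- throughout.
  rw [Finset.sum_comm (f := fun i j => if p.get j = east ∧ p.get i = north ∧ i < j ∧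
    rank m n p j ≤ rank m n p i then (1 : ℤ) else 0)]
  simp only [← Finset.sum_add_distrib]
  refine Finset.sum_congr rfl fun i _ => Finset.sum_congr rfl fun j _ => ?_
  by_cases hi : p.get i = east
  swap
  · simp only [hi, eastNorth, false_and, if_false, ite_self, add_zero]
  by_cases hj : p.get j = north
  swap
  · simp only [hj, eastNorth, false_and, and_false, if_false, ite_self, add_zero]
  have hij : i ≠ j := by
    rintro rfl
    exact absurd (hi.symm.trans hj) (by decide)
  simp only [hi, hj, eastNorth, SweepLE, true_and, and_self, if_true]
  split_ifs <;> omega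

end RationalDyck

theorem mainTheorem1 (m n d : ℕ) (hm : 0 < m) (hn : 0 < n) (hmn : Nat.Coprime m n) (hd : 1 ≤ d)
    (p : List RationalDyck.Step) (hp : RationalDyck.IsDyck m n d p) :
    RationalDyck.IsDyck m n d (RationalDyck.sweep m n p) ∧
      RationalDyck.dinv m n d p = RationalDyck.area m n d (RationalDyck.sweep m n p) := by
  refine ⟨hp.sweep, ?_⟩
  have h1 := RationalDyck.dinv_add_pairSum_sweep hp.1 hp.2.1
  have h2 := RationalDyck.area_add_pairSum hp.sweep
  have h3 := RationalDyck.pairSum_eq_card_above_diagonal hm hp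
  omega
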